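/- Proposition 3.1. Let $K$ be an algebraically closed field of characteristic zero, and let $H=(u(x,y,z),v(x,y),h(x,y))$ be a polynomial map with $u\in K[x,y,z]$ and $v,h\in K[x,y]$. Assume that $H(0)=0$, that $u,v,h$ are linearly independent over $K$, and that the Jacobian matrix $JH$ is nilpotent. Write $\deg_x$ for the degree in the variable $x$. If $\gcd(\deg_x v,\deg_x h)\le 3$, or at least one of $\deg_x v$, $\deg_x h$ is a prime number, then there are $u_1,c_0,a\in K\setminus\{0\}$, $l_1,l_2,\tilde l_2\in K$ and a polynomial $g(t)\in K[t]$ with $g(0)=0$ and $\deg_t g\ge 1$ such that, with $b(y)=u_1c_0a\,y^2+l_1y+\tilde l_2$, $$u=u_1z-a^{-1}b'(y)\,g(ax+b(y))-u_1l_2\,y,\qquad v=g(ax+b(y)),\qquad h=c_0v^2+l_2v .$$ -/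

import Mathlib

/-- The Jacobian matrix `JF = (∂F_i/∂x_j)` of a polynomial map `F = (F_1, …, F_n)`. -/
noncomputable def polyJacobian {K : Type*} [Field K] {n : ℕ}
    (F : Fin n → MvPolynomial (Fin n) K) : Matrix (Fin n) (Fin n) (MvPolynomial (Fin n) K) :=
  Matrix.of fun i j => MvPolynomial.pderiv j (F i)

/-! Nilpotency makes the trace, the sum of the principal 2×2 minors and the determinant of `JH`
vanish. In `K[y][x][z]`, comparing powers of `z` in these relations and using linear independence
gives `u = u₁z + U(x,y)` with `u₁` constant (`trivariate_normal_form`). With `V = v` and `W = u₁h`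
there remains the system `U_x = -V_y`, `V_y² + U_y V_x + W_x = 0`, `V_x W_y = V_y W_x`, where `V_x ≠
0`.

The crux is that `V` is a polynomial in `x + b(y)`. Top coefficients in `x` show that the leading
coefficient of `V` is constant (`derivative_leadingCoeff_eq_zero`). Hence prime factors of `V_x`
involve `x`; each divides `V_y` by the system, and with full multiplicity because the two
derivations commute (`pow_dvd_of_commuting_derivations`). So `V_x ∣ V_y`, and by degree the quotient
is some `b'(y)`.

The shear `x ↦ x - b(y)` turns `V`, `W` into `A(x)`, `B(x)` and `U` into `c(y) - b'A`, and the
second equation into `(c' - b''A)A' + B' = 0`. Hence `b''` and `c'` are constant and `B` is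
quadratic in `A` (`quadratic_of_sheared_relation`). Independence makes `u₁` and the quadratic
coefficient nonzero. -/

open Polynomial in
/-- Apply a derivation to the coefficients of a polynomial. -/
noncomputable def coeffDeriv {K A : Type*} [CommRing K] [CommRing A] [Algebra K A]
    (D : Derivation K A A) : Derivation K A[X] A[X] :=
  (PolynomialModule.equivPolynomialSelf (R := A)).toLinearMap.compDer D.mapCoeffs

/-! ### Derivations acting on coefficients -/

section coeffDeriv

open Polynomial

variable {K A : Type*} [CommRing K] [CommRing A] [Algebra K A] (D : Derivation K A A)

@[simp]
lemma coeff_coeffDeriv (p : A[X]) (n : ℕ) : (coeffDeriv D p).coeff n = D (p.coeff n) := rfl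

@[simp]
lemma coeffDeriv_C (a : A) : coeffDeriv D (C a) = C (D a) := by
  ext n
  simp only [coeff_coeffDeriv, coeff_C]
  split_ifs <;> simp

@[simp]
lemma coeffDeriv_X : coeffDeriv D X = 0 := by
  ext n
  simp only [coeff_coeffDeriv, coeff_X]
  split_ifs <;> simp

lemma derivative_coeffDeriv (p : A[X]) :
    derivative (coeffDeriv D p) = coeffDeriv D (derivative p) := by
  ext n
  rw [coeff_derivative, coeff_coeffDeriv, coeff_coeffDeriv, coeff_derivative, D.leibniz]
  have : D ((n : A) + 1) = 0 := by
    exact_mod_cast D.map_natCast (n + 1)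
  rw [this, smul_zero, zero_add, smul_eq_mul, mul_comm]

lemma natDegree_coeffDeriv_le (p : A[X]) : (coeffDeriv D p).natDegree ≤ p.natDegree := by
  rw [natDegree_le_iff_coeff_eq_zero]
  intro n hn
  rw [coeff_coeffDeriv, coeff_eq_zero_of_natDegree_lt hn, map_zero]

/-- Chain rule for `p(X + b)`: the shift `b` is itself differentiated by `D`. This governs `∂/∂y`
under the shear. -/
lemma coeffDeriv_taylor (b : A) (p : A[X]) :
    coeffDeriv D (taylor b p) =
      taylor b (coeffDeriv D p) + C (D b) * taylor b (derivative p) := by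
  induction p using Polynomial.induction_on' with
  | add p q hp hq => simp only [map_add, hp, hq]; ring
  | monomial n a =>
    rw [← C_mul_X_pow_eq_monomial]
    have hcast : taylor b (n : A[X]) = n := by simp [taylor_apply]
    simp only [hcast, Derivation.leibniz, taylor_mul, taylor_pow, taylor_C, taylor_X, smul_eq_mul, map_add,
      Derivation.leibniz_pow, coeffDeriv_C, coeffDeriv_X, derivative_mul, derivative_C,
      derivative_X_pow, zero_add, nsmul_eq_mul, mul_zero, zero_mul, taylor_C, map_natCast, smul_zero]
    ring

lemma derivative_taylor' (b : A) (p : A[X]) :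
    derivative (taylor b p) = taylor b (derivative p) := by
  simp [taylor_apply, derivative_comp]

end coeffDeriv

/-! ### Multiplicities of prime factors under commuting derivations -/

section PrimeDivisors

/-- If `p` divides both partial derivatives `∂ F` and `δ F`, and `p ∤ ∂ p`, then the full power of
`p` dividing `∂ F` also divides `δ F`. -/
lemma pow_dvd_of_commuting_derivations {K R : Type*} [Field K] [CharZero K] [CommRing R] [IsDomain R]
    [Algebra K R] (d e : Derivation K R R) (F p : R) (hp : Prime p)
    (hcomm : d (e F) = e (d F)) (hpd : ¬ p ∣ d p) (he : p ∣ e F) (n : ℕ) (hn : p ^ n ∣ d F) :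
    p ^ n ∣ e F := by
  have key : ∀ j, j ≤ n → p ^ j ∣ e F := by
    intro j
    induction j with
    | zero => simp
    | succ j ih =>
      intro hj
      rcases Nat.eq_zero_or_pos j with rfl | hj0
      · simpa using he
      obtain ⟨s, hs⟩ := ih (by omega)
      obtain ⟨t, ht⟩ := (pow_dvd_pow p hj).trans hn
      have h1 : d (e F) = p ^ j * d s + s * (j * (p ^ (j - 1) * d p)) := by
        rw [hs, Derivation.leibniz, Derivation.leibniz_pow]
        simp only [smul_eq_mul, nsmul_eq_mul]
      have h2 : e (d F) = p ^ (j + 1) * e t + t * ((j + 1 : ℕ) * (p ^ j * e p)) := by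
        rw [ht, Derivation.leibniz, Derivation.leibniz_pow]
        simp only [smul_eq_mul, nsmul_eq_mul, Nat.add_sub_cancel]
      obtain ⟨i, rfl⟩ : ∃ i, j = i + 1 := ⟨j - 1, by omega⟩
      -- With `e F = p^j s` and `d F = p^(j+1) t`, every term of `d (e F) = e (d F)` except `j
      -- p^(j-1) s (d p)` is visibly divisible by `p^j`, so `p ∣ j s (d p)`. In characteristic zero
      -- `j` is a unit, which leaves `p ∣ s`.
      have h3 : p ^ i * (((i + 1 : ℕ) : R) * (s * d p)) =
          p ^ i * (p * (p * e t + t * ((i + 1 + 1 : ℕ) * e p) - d s)) := by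
        rw [h1, h2] at hcomm
        simp only [Nat.add_sub_cancel] at hcomm
        linear_combination hcomm
      have h4 : p ∣ ((i + 1 : ℕ) : R) * (s * d p) := by
        exact ⟨_, mul_left_cancel₀ (pow_ne_zero i hp.ne_zero) h3⟩
      have hu : IsUnit ((i + 1 : ℕ) : R) := by
        have : IsUnit ((i + 1 : ℕ) : K) := (Nat.cast_ne_zero.2 (Nat.succ_ne_zero i)).isUnit
        simpa using this.map (algebraMap K R)
      have h5 : p ∣ s := by
        rcases hp.dvd_or_dvd h4 with h | h
        · exact absurd (isUnit_of_dvd_unit h hu) hp.not_isUnit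
        · exact (hp.dvd_or_dvd h).resolve_right hpd
      rw [hs, pow_succ]
      exact mul_dvd_mul_left _ h5
  exact key n le_rfl

end PrimeDivisors

/-! ### Leading coefficient of `V`, and `V_x ∣ V_y` -/

section Bivariate

open Polynomial

variable {K : Type*} [Field K]

variable (K) in
/-- The derivation `∂/∂y` on `K[y][x]`. -/
noncomputable abbrev yDeriv : Derivation K K[X][X] K[X][X] := coeffDeriv derivative'

lemma coeff_yDeriv (p : K[X][X]) (n : ℕ) :
    (yDeriv K p).coeff n = derivative (p.coeff n) := rfl

/-- A pair of polynomials `q, r` in one variable with `r^n` proportional to `q^(2n+1)` cannot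
satisfy the displayed second order relation, unless `q` is constant. -/
lemma derivative_eq_zero_of_quadratic_relation [CharZero K] (N : ℕ) (hN : 0 < N) (q r : K[X])
    (h1 : (N : K[X]) * (q * derivative r) = (2 * N + 1) * (r * derivative q))
    (h2 : (N + 1) * derivative q ^ 2 - N * (q * derivative (derivative q))
      + (N + 1) * (2 * N + 1) * r = 0) : derivative q = 0 := by
  by_contra hq
  have hq0 : q ≠ 0 := by rintro rfl; simp at hq
  set e := q.natDegree with he
  have he0 : 0 < e := by
    rcases Nat.eq_zero_or_pos e with h | h
    · exact absurd (derivative_of_natDegree_zero h) hq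
    · exact h
  have hqe : q.coeff e ≠ 0 := by simpa [he] using hq0
  have hXd : ∀ p : K[X], (X * derivative p).coeff p.natDegree = p.natDegree * p.leadingCoeff := by
    intro p
    rcases Nat.eq_zero_or_pos p.natDegree with h | h
    · rw [h]; simp
    · obtain ⟨m, hm⟩ : ∃ m, p.natDegree = m + 1 := ⟨p.natDegree - 1, by omega⟩
      rw [leadingCoeff, hm, coeff_X_mul, coeff_derivative]; push_cast; ring
  have hXdeg : ∀ p : K[X], (X * derivative p).natDegree ≤ p.natDegree := by
    intro p
    rcases Nat.eq_zero_or_pos p.natDegree with h | h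
    · rw [derivative_of_natDegree_zero h]; simp
    · refine natDegree_mul_le.trans ?_
      have := natDegree_derivative_lt h.ne'
      rw [natDegree_X]; omega
  -- The Euler operator `X d/dX` does not raise degrees and multiplies the top coefficient by the
  -- degree, so top coefficients can be compared without degree subtraction.
  set Q := X * derivative q with hQ
  have hQ2 : X ^ 2 * derivative (derivative q) = X * derivative Q - Q := by
    rw [hQ, derivative_mul, derivative_X]; ring
  have hQdeg : Q.natDegree ≤ e := hXdeg q
  have hXQdeg : (X * derivative Q).natDegree ≤ e := (hXdeg Q).trans hQdeg
  have hQe : Q.coeff e = e * q.coeff e := hXd q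
  have hQne : Q.natDegree = e := by
    refine natDegree_eq_of_le_of_coeff_ne_zero hQdeg ?_
    rw [hQe]; exact mul_ne_zero (Nat.cast_ne_zero.2 he0.ne') hqe
  have hXQe : (X * derivative Q).coeff e = e * (e * q.coeff e) := by
    have := hXd Q
    rwa [leadingCoeff, hQne, hQe] at this
  have hDdeg : (X * derivative Q - Q).natDegree ≤ e := by
    simpa using natDegree_sub_le_of_le hXQdeg hQdeg
  have h3 : C ((N : K) + 1) * Q ^ 2 - C (N : K) * (q * (X * derivative Q - Q))
      + C (((N : K) + 1) * (2 * N + 1)) * (X ^ 2 * r) = 0 := by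
    rw [← hQ2, hQ]
    simp only [C_add, C_mul, C_1, map_natCast, map_ofNat]
    linear_combination X ^ 2 * h2
  have h4 : C (N : K) * (q * (X * derivative r)) = C (2 * (N : K) + 1) * (r * Q) := by
    rw [hQ]
    simp only [C_add, C_mul, C_1, map_natCast, map_ofNat]
    linear_combination X * h1
  have hQ2e : (Q ^ 2).coeff (e + e) = (e * q.coeff e) * (e * q.coeff e) := by
    rw [sq, coeff_mul_add_eq_of_natDegree_le hQdeg hQdeg, hQe]
  have hqD : (q * (X * derivative Q - Q)).coeff (e + e)
      = q.coeff e * (e * (e * q.coeff e) - e * q.coeff e) := by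
    rw [coeff_mul_add_eq_of_natDegree_le le_rfl hDdeg, coeff_sub, hXQe, hQe]
  -- If `r = 0`, the coefficient of `X^(2e)` is a nonzero multiple of `(N+1)e² - N e(e-1) = e(e+N)`.
  -- Otherwise `Nρ = (2N+1)e` gives `ρ > 2e`, and `X² r` cannot be cancelled.
  by_cases hr : r = 0
  · have := congrArg (fun p => p.coeff (e + e)) h3
    simp only [hr, mul_zero, add_zero, coeff_sub, coeff_C_mul, hQ2e, hqD, coeff_zero] at this
    have h5 : (q.coeff e) ^ 2 * ((e * (e + N) : ℕ) : K) = 0 := by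
      push_cast; linear_combination this
    have h6 := (mul_eq_zero.1 h5).resolve_left (pow_ne_zero 2 hqe)
    rw [Nat.cast_eq_zero] at h6
    have : 0 < e * (e + N) := by positivity
    omega
  · set ρ := r.natDegree with hρ
    have hrρ : r.coeff ρ ≠ 0 := by simpa [hρ] using hr
    have h5 := congrArg (fun p => p.coeff (e + ρ)) h4
    simp only [coeff_C_mul] at h5
    rw [coeff_mul_add_eq_of_natDegree_le le_rfl (hXdeg r), add_comm e ρ,
      coeff_mul_add_eq_of_natDegree_le le_rfl hQdeg, hXd r, hQe, leadingCoeff] at h5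
    have h6 : ((N * ρ : ℕ) : K) = ((2 * N + 1) * e : ℕ) := by
      apply mul_left_cancel₀ (mul_ne_zero hqe hrρ)
      push_cast
      linear_combination h5
    have h7 : N * ρ = (2 * N + 1) * e := by exact_mod_cast h6
    have h8 : e + e < ρ + 2 := by
      by_contra! hlt
      nlinarith [Nat.mul_le_mul_left N hlt]
    have h9 := congrArg (fun p => p.coeff (ρ + 2)) h3
    have hA : (Q ^ 2).coeff (ρ + 2) = 0 := by
      apply coeff_eq_zero_of_natDegree_lt
      have : (Q ^ 2).natDegree ≤ 2 * Q.natDegree := natDegree_pow_le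
      omega
    have hB : (q * (X * derivative Q - Q)).coeff (ρ + 2) = 0 := by
      apply coeff_eq_zero_of_natDegree_lt
      have : (q * (X * derivative Q - Q)).natDegree ≤ e + (X * derivative Q - Q).natDegree :=
        natDegree_mul_le
      omega
    simp only [coeff_add, coeff_sub, coeff_C_mul, hA, hB, mul_zero, sub_zero, zero_add,
      coeff_zero] at h9
    rw [coeff_X_pow_mul] at h9
    have h10 : ((((N + 1) * (2 * N + 1) : ℕ) : K)) ≠ 0 := Nat.cast_ne_zero.2 (by positivity)
    push_cast at h10
    exact mul_ne_zero h10 hrρ h9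

/-- The leading coefficient in `x` of `V` is constant. -/
lemma derivative_leadingCoeff_eq_zero [CharZero K] (V U W : K[X][X])
    (hV : derivative V ≠ 0) (h1 : derivative U = - yDeriv K V)
    (h2 : yDeriv K V ^ 2 + yDeriv K U * derivative V + derivative W = 0)
    (h3 : derivative V * yDeriv K W = yDeriv K V * derivative W) :
    derivative V.leadingCoeff = 0 := by
  obtain ⟨n, hn⟩ : ∃ n, V.natDegree = n + 1 := by
    refine ⟨V.natDegree - 1, ?_⟩
    have : V.natDegree ≠ 0 := fun h => hV (derivative_of_natDegree_zero h)
    omega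
  have hVd : (derivative V).natDegree ≤ n := by
    have := natDegree_derivative_le V; omega
  have hVy : (yDeriv K V).natDegree ≤ n + 1 := hn ▸ natDegree_coeffDeriv_le _ V
  have hUd : U.natDegree ≤ n + 2 := by
    rw [natDegree_le_iff_coeff_eq_zero]
    intro m hm
    obtain ⟨k, rfl⟩ : ∃ k, m = k + 1 := ⟨m - 1, by omega⟩
    have := congrArg (fun p => p.coeff k) h1
    simp only [coeff_derivative, coeff_neg] at this
    rw [coeff_eq_zero_of_natDegree_lt (p := yDeriv K V) (by omega), neg_zero] at this
    refine (mul_eq_zero.1 this).resolve_right ?_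
    exact_mod_cast Nat.succ_ne_zero k
  have hUc : (n + 2) * U.coeff (n + 2) = - derivative (V.coeff (n + 1)) := by
    have := congrArg (fun p => p.coeff (n + 1)) h1
    simp only [coeff_derivative, coeff_neg, coeff_yDeriv] at this
    push_cast at this
    linear_combination this
  have hUy : (yDeriv K U).natDegree ≤ n + 2 := (natDegree_coeffDeriv_le _ U).trans hUd
  have hsq : (yDeriv K V ^ 2).natDegree ≤ 2 * n + 2 := by
    have : (yDeriv K V ^ 2).natDegree ≤ 2 * (yDeriv K V).natDegree := natDegree_pow_le
    omega
  have hUV : (yDeriv K U * derivative V).natDegree ≤ 2 * n + 2 := by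
    have : (yDeriv K U * derivative V).natDegree ≤ _ := natDegree_mul_le
    omega
  have hWx : (derivative W).natDegree ≤ 2 * n + 2 := by
    have : derivative W = - (yDeriv K V ^ 2 + yDeriv K U * derivative V) := by
      linear_combination h2
    rw [this, natDegree_neg]
    exact natDegree_add_le_of_degree_le hsq hUV
  have hWd : W.natDegree ≤ 2 * n + 3 := by
    rw [natDegree_le_iff_coeff_eq_zero]
    intro m hm
    obtain ⟨k, rfl⟩ : ∃ k, m = k + 1 := ⟨m - 1, by omega⟩
    have : (derivative W).coeff k = 0 := coeff_eq_zero_of_natDegree_lt (by omega)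
    rw [coeff_derivative] at this
    refine (mul_eq_zero.1 this).resolve_right ?_
    exact_mod_cast Nat.succ_ne_zero k
  have hWy : (yDeriv K W).natDegree ≤ 2 * n + 3 := (natDegree_coeffDeriv_le _ W).trans hWd
  rw [leadingCoeff, hn]
  set q := V.coeff (n + 1) with hq
  set r := W.coeff (2 * n + 3) with hr
  -- The degree bounds `n+1`, `n+2`, `2n+3` for `V`, `U`, `W` make these the top coefficients of
  -- `h3` and `h2`; eliminating the one of `U` yields the one-variable relations with `N = n + 1`.
  have e3 := congrArg (fun p => p.coeff (n + (2 * n + 3))) h3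
  beta_reduce at e3
  rw [coeff_mul_add_eq_of_natDegree_le hVd hWy,
    show n + (2 * n + 3) = (n + 1) + (2 * n + 2) by ring,
    coeff_mul_add_eq_of_natDegree_le hVy hWx, coeff_derivative, coeff_derivative,
    coeff_yDeriv, coeff_yDeriv, ← hq, ← hr] at e3
  have e2 := congrArg (fun p => p.coeff (2 * n + 2)) h2
  simp only [coeff_add, coeff_zero] at e2
  rw [show 2 * n + 2 = (n + 2) + n by ring, coeff_mul_add_eq_of_natDegree_le hUy hVd,
    show (n + 2) + n = (n + 1) + (n + 1) by ring, sq,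
    coeff_mul_add_eq_of_natDegree_le hVy hVy, coeff_derivative, coeff_derivative,
    show n + 1 + (n + 1) + 1 = 2 * n + 3 by ring,
    coeff_yDeriv, coeff_yDeriv, ← hq, ← hr] at e2
  have hUc' : (n + 2) * derivative (U.coeff (n + 2)) = - derivative (derivative q) := by
    have := congrArg derivative hUc
    have h2 : derivative ((n : K[X]) + 2) = 0 := by
      exact_mod_cast derivative_natCast (R := K) (n := n + 2)
    rw [derivative_mul, h2, derivative_neg] at this
    linear_combination this
  refine derivative_eq_zero_of_quadratic_relation (n + 1) (Nat.succ_pos n) q r ?_ ?_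
  · push_cast at e3 ⊢
    linear_combination e3
  · push_cast at e2 ⊢
    linear_combination (n + 2) * e2 - q * (n + 1) * hUc'

/-- `∂V/∂x` divides `∂V/∂y`. -/
lemma derivative_dvd_yDeriv [CharZero K] (V U W : K[X][X])
    (hV : derivative V ≠ 0) (hlead : derivative V.leadingCoeff = 0)
    (h2 : yDeriv K V ^ 2 + yDeriv K U * derivative V + derivative W = 0)
    (h3 : derivative V * yDeriv K W = yDeriv K V * derivative W) :
    derivative V ∣ yDeriv K V := by
  have hV0 : V ≠ 0 := by rintro rfl; simp at hV
  have hlu : IsUnit V.leadingCoeff := by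
    have h0 := derivative_eq_zero.1 hlead
    rw [natDegree_eq_zero] at h0
    obtain ⟨c, hc⟩ := h0
    have hc0 : c ≠ 0 := by
      rintro rfl
      rw [C_0] at hc
      exact hV0 (leadingCoeff_eq_zero.1 hc.symm)
    rw [← hc]
    exact isUnit_C.2 hc0.isUnit
  have hN : V.natDegree ≠ 0 := fun h => hV (derivative_of_natDegree_zero h)
  have hdu : IsUnit (derivative V).leadingCoeff := by
    rw [leadingCoeff_derivative]
    refine hlu.mul ?_
    have : IsUnit (V.natDegree : K) := (Nat.cast_ne_zero.2 hN).isUnit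
    simpa using this.map (algebraMap K K[X])
  rw [UniqueFactorizationMonoid.dvd_iff_emultiplicity_le hV]
  intro p hp
  rw [emultiplicity_le_emultiplicity_iff]
  intro n hn
  rcases Nat.eq_zero_or_pos n with rfl | hn0
  · simp
  have hpV : p ∣ derivative V := (dvd_pow_self p hn0.ne').trans hn
  have hpu : IsUnit p.leadingCoeff :=
    isUnit_of_dvd_unit (leadingCoeff_dvd_leadingCoeff hpV) hdu
  -- The leading coefficient of `p` divides that of `V_x`, a unit; a prime of degree zero in `x`
  -- would then be a unit itself.
  have hpd : p.natDegree ≠ 0 := by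
    intro h
    apply hp.not_isUnit
    rw [eq_C_of_natDegree_eq_zero h]
    rw [leadingCoeff, h] at hpu
    exact isUnit_C.2 hpu
  have hpp : ¬ p ∣ derivative p := by
    intro h
    exact hpd (derivative_eq_zero.1
      (eq_zero_of_dvd_of_natDegree_lt h (natDegree_derivative_lt hpd)))
  have hpy : p ∣ yDeriv K V := by
    have : p ∣ yDeriv K V * derivative W := h3 ▸ hpV.mul_right _
    rcases hp.dvd_or_dvd this with h | h
    · exact h
    · apply hp.dvd_of_dvd_pow (n := 2)
      have h4 : yDeriv K V ^ 2 = - (yDeriv K U * derivative V + derivative W) := by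
        linear_combination h2
      rw [h4]
      exact ((hpV.mul_left _).add h).neg_right
  exact pow_dvd_of_commuting_derivations (derivative'.restrictScalars K) (yDeriv K) V p hp
    (derivative_coeffDeriv _ V) hpp hpy n hn

end Bivariate

/-! ### Straightening `V` by a shear and solving the system -/

section Shear

open Polynomial

variable {K : Type*} [Field K] [CharZero K]

lemma exists_antiderivative (p : K[X]) : ∃ b : K[X], b.eval 0 = 0 ∧ derivative b = p := by
  induction p using Polynomial.induction_on' with
  | add p q hp hq =>
    obtain ⟨b, hb0, hb⟩ := hp
    obtain ⟨c, hc0, hc⟩ := hq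
    exact ⟨b + c, by simp [hb0, hc0], by simp [hb, hc]⟩
  | monomial n a =>
    refine ⟨monomial (n + 1) (a / (n + 1)), by simp [eval_monomial], ?_⟩
    have : (n : K) + 1 ≠ 0 := by exact_mod_cast Nat.succ_ne_zero n
    simp [this]

lemma exists_map_C_of_yDeriv_eq_zero (p : K[X][X]) (h : yDeriv K p = 0) :
    ∃ A : K[X], p = A.map C := by
  refine ⟨p.map (evalRingHom 0), ?_⟩
  ext1 n
  have hn : derivative (p.coeff n) = 0 := by rw [← coeff_yDeriv, h, coeff_zero]
  rw [coeff_map, coeff_map, coe_evalRingHom]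
  rw [eq_C_of_derivative_eq_zero hn, eval_C]

/-- `V` is a polynomial in `x + b(y)`, at the level of derivations. -/
lemma exists_yDeriv_eq (V U W : K[X][X])
    (hV : derivative V ≠ 0) (hlead : derivative V.leadingCoeff = 0)
    (h2 : yDeriv K V ^ 2 + yDeriv K U * derivative V + derivative W = 0)
    (h3 : derivative V * yDeriv K W = yDeriv K V * derivative W) :
    ∃ b : K[X], b.eval 0 = 0 ∧ yDeriv K V = C (derivative b) * derivative V := by
  obtain ⟨s, hs⟩ := derivative_dvd_yDeriv V U W hV hlead h2 h3
  have hN : V.natDegree ≠ 0 := fun h => hV (derivative_of_natDegree_zero h)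
  -- The leading coefficient is killed by `∂/∂y`, so `V_y` has no larger `x`-degree than `V_x`, and
  -- the quotient `s` lies in `K[y]`.
  have hy : (yDeriv K V).natDegree ≤ V.natDegree - 1 := by
    rw [natDegree_le_iff_coeff_eq_zero]
    intro m hm
    rw [coeff_yDeriv]
    rcases (show V.natDegree ≤ m by omega).eq_or_lt with h | h
    · rw [← h]; exact hlead
    · rw [coeff_eq_zero_of_natDegree_lt h, derivative_zero]
  have hs0 : s.natDegree = 0 := by
    by_cases h0 : s = 0
    · simp [h0]
    · rw [hs, natDegree_mul hV h0, natDegree_derivative] at hy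
      omega
  obtain ⟨b, hb0, hb⟩ := exists_antiderivative (s.coeff 0)
  refine ⟨b, hb0, ?_⟩
  rw [hs, hb, mul_comm, ← eq_C_of_natDegree_eq_zero hs0]

/-- A solution that is independent of `y` after the shear `x ↦ x - b(y)`. -/
lemma quadratic_of_sheared_relation (A B : K[X]) (b c : K[X]) (hA : derivative A ≠ 0)
    (h : (C (derivative c) - C (derivative (derivative b)) * A.map C) * (derivative A).map C
      + (derivative B).map C = 0) :
    ∃ κ d w : K, derivative (derivative b) = C (2 * κ) ∧ derivative c = C d ∧
      B = C κ * A ^ 2 - C d * A + C w := by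
  set p := derivative (derivative b) with hp
  set q := derivative c with hq
  -- Subtracting the relation at `y = 0` eliminates `B`; as `A` is nonconstant in `x`, both `p` and
  -- `q` must equal their values at `0`.
  have h0 := congrArg (Polynomial.map (evalRingHom 0)) h
  have hcomp : (evalRingHom (0 : K)).comp (C : K →+* K[X]) = RingHom.id K := by ext; simp
  simp only [Polynomial.map_add, Polynomial.map_mul, Polynomial.map_sub, map_map, hcomp,
    map_id, map_C, coe_evalRingHom, Polynomial.map_zero] at h0
  have h1 := congrArg (Polynomial.map (C : K →+* K[X])) h0
  simp only [Polynomial.map_add, Polynomial.map_mul, Polynomial.map_sub, map_C,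
    Polynomial.map_zero] at h1
  have hA' : (derivative A).map (C : K →+* K[X]) ≠ 0 :=
    (Polynomial.map_ne_zero_iff C_injective).2 hA
  have h2 : C (q - C (q.eval 0)) = C (p - C (p.eval 0)) * A.map C := by
    apply mul_right_cancel₀ hA'
    simp only [C_sub]
    linear_combination h - h1
  have hN : A.natDegree ≠ 0 := fun h => hA (derivative_of_natDegree_zero h)
  have h3 := congrArg (fun f => f.coeff A.natDegree) h2
  simp only [coeff_C_mul, coeff_C_of_ne_zero hN, coeff_map] at h3
  have hlc : (C (A.coeff A.natDegree) : K[X]) ≠ 0 := by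
    rw [C_ne_zero]
    refine leadingCoeff_ne_zero.2 ?_
    rintro rfl; simp at hA
  have hp0 : p - C (p.eval 0) = 0 := (mul_eq_zero.1 h3.symm).resolve_right hlc
  have hq0 : q - C (q.eval 0) = 0 := by
    rw [hp0, C_0, zero_mul] at h2
    exact C_eq_zero.1 h2
  have hB : derivative (B - (C (p.eval 0 / 2) * A ^ 2 - C (q.eval 0) * A)) = 0 := by
    have h4 : (C (p.eval 0) : K[X]) = 2 * C (p.eval 0 / 2) := by
      rw [← map_ofNat C 2, ← C_mul]; congr 1; field_simp
    simp only [sq, derivative_sub, derivative_C, derivative_mul]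
    simp only [h4] at h0
    linear_combination h0
  have hB' := eq_C_of_derivative_eq_zero hB
  refine ⟨p.eval 0 / 2, q.eval 0,
    (B - (C (p.eval 0 / 2) * A ^ 2 - C (q.eval 0) * A)).coeff 0, ?_, sub_eq_zero.1 hq0, ?_⟩
  · rw [mul_div_cancel₀ _ (two_ne_zero)]; exact sub_eq_zero.1 hp0
  · linear_combination hB'

/-- The solutions of the system of partial differential equations. -/
theorem exists_sheared_form (V U W : K[X][X])
    (hV : derivative V ≠ 0) (h1 : derivative U = - yDeriv K V)
    (h2 : yDeriv K V ^ 2 + yDeriv K U * derivative V + derivative W = 0)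
    (h3 : derivative V * yDeriv K W = yDeriv K V * derivative W) :
    ∃ (A : K[X]) (κ l d e w : K), A.natDegree ≠ 0 ∧
      V = taylor (C κ * X ^ 2 + C l * X) (A.map C) ∧
      U = C (C d * X + C e) - C (derivative (C κ * X ^ 2 + C l * X)) * V ∧
      W = C (C κ) * V ^ 2 - C (C d) * V + C (C w) := by
  have hlead := derivative_leadingCoeff_eq_zero V U W hV h1 h2 h3
  obtain ⟨b, hb0, hb⟩ := exists_yDeriv_eq V U W hV hlead h2 h3
  have hWb : yDeriv K W = C (derivative b) * derivative W := by
    apply mul_left_cancel₀ hV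
    rw [h3, hb]; ring
  have hback : ∀ f : K[X][X], taylor b (taylor (-b) f) = f := by
    intro f; rw [taylor_taylor, add_neg_cancel, taylor_zero]
  have hTy : ∀ f : K[X][X], yDeriv K (taylor (-b) f) =
      taylor (-b) (yDeriv K f) - C (derivative b) * taylor (-b) (derivative f) := by
    intro f
    rw [coeffDeriv_taylor, map_neg, C_neg]
    show _ + -C (derivative b) * _ = _
    ring
  obtain ⟨A, hA⟩ := exists_map_C_of_yDeriv_eq_zero (taylor (-b) V) (by
    rw [hTy, hb, taylor_mul, taylor_C, sub_self])
  obtain ⟨B, hB⟩ := exists_map_C_of_yDeriv_eq_zero (taylor (-b) W) (by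
    rw [hTy, hWb, taylor_mul, taylor_C, sub_self])
  have hVx : taylor (-b) (derivative V) = (derivative A).map C := by
    rw [← derivative_taylor', hA, derivative_map]
  have hWx : taylor (-b) (derivative W) = (derivative B).map C := by
    rw [← derivative_taylor', hB, derivative_map]
  have hA0 : derivative A ≠ 0 := by
    intro h
    rw [h, Polynomial.map_zero, taylor_eq_zero] at hVx
    exact hV hVx
  -- `U_x = -V_y = -b' V_x`, so `U + b'V` depends on `y` alone.
  have hUx : derivative (taylor (-b) U + C (derivative b) * A.map C) = 0 := by
    rw [derivative_add, derivative_taylor', h1, hb, derivative_C_mul, derivative_map, map_neg,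
      taylor_mul, taylor_C, hVx]
    ring
  obtain ⟨c, hc⟩ : ∃ c, taylor (-b) U = - C (derivative b) * A.map C + C c :=
    ⟨_, by linear_combination eq_C_of_derivative_eq_zero hUx⟩
  have hUy : taylor (-b) (yDeriv K U) = C (derivative c)
      - C (derivative (derivative b)) * A.map C
      - C (derivative b) ^ 2 * (derivative A).map C := by
    have hAy : yDeriv K (A.map C) = 0 := by
      rw [← hA, hTy, hb, taylor_mul, taylor_C, sub_self]
    have e1 := hTy U
    have e2 : yDeriv K (taylor (-b) U) =
        - C (derivative (derivative b)) * A.map C + C (derivative c) := by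
      rw [hc, map_add, Derivation.leibniz, hAy, map_neg, coeffDeriv_C, coeffDeriv_C, smul_zero,
        zero_add, smul_eq_mul]
      show A.map C * (-C (derivative (derivative b))) + C (derivative c) = _
      ring
    have e3 : taylor (-b) (derivative U) = - (C (derivative b) * (derivative A).map C) := by
      rw [h1, hb, map_neg, taylor_mul, taylor_C, hVx]
    rw [e2, e3] at e1
    linear_combination -e1
  have hrel := congrArg (taylor (-b)) h2
  rw [map_add, map_add, taylor_pow, taylor_mul, hb, taylor_mul, taylor_C, hVx, hWx, hUy,
    map_zero] at hrel
  obtain ⟨κ, d, w, hκ, hd, hBA⟩ := quadratic_of_sheared_relation A B b c hA0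
    (by linear_combination hrel)
  have hVA : V = taylor b (A.map C) := by rw [← hA, hback]
  have hbq : b = C κ * X ^ 2 + C ((derivative b).eval 0) * X := by
    have e1 : derivative (derivative b - C (2 * κ) * X) = 0 := by simp [hκ]
    have e2 := eq_C_of_derivative_eq_zero e1
    rw [coeff_zero_eq_eval_zero] at e2
    have e3 : derivative (b - (C κ * X ^ 2 + C ((derivative b).eval 0) * X)) = 0 := by
      simp only [eval_sub, eval_mul, eval_C, eval_X, mul_zero, sub_zero, C_mul] at e2
      simp only [derivative_sub, derivative_add, derivative_C_mul, derivative_X_pow, derivative_X]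
      norm_num at e2 ⊢
      linear_combination e2
    have e4 := eq_C_of_derivative_eq_zero e3
    rw [coeff_zero_eq_eval_zero] at e4
    simpa [hb0, sub_eq_zero] using e4
  have hcq : c = C d * X + C (c.coeff 0) := by
    have e1 : derivative (c - C d * X) = 0 := by simp [hd]
    have e2 := eq_C_of_derivative_eq_zero e1
    rw [coeff_sub, coeff_C_mul, coeff_X_zero, mul_zero, sub_zero] at e2
    linear_combination e2
  refine ⟨A, κ, (derivative b).eval 0, d, c.coeff 0, w, derivative_ne_zero.1 hA0, ?_, ?_, ?_⟩
  · rw [← hbq]; exact hVA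
  · rw [← hbq, ← hcq]
    have := congrArg (taylor b) hc
    rw [hback, map_add, taylor_mul, map_neg, taylor_C, taylor_C, ← hVA] at this
    linear_combination this
  · have := congrArg (taylor b) hB
    rw [hback, hBA] at this
    simpa only [Polynomial.map_add, Polynomial.map_sub, Polynomial.map_mul, Polynomial.map_pow,
      map_C, map_add, map_sub, taylor_mul, taylor_pow, taylor_C, ← hVA] using this

end Shear

/-! ### Eliminating `z` -/

section Trivariate

open Polynomial

variable {K : Type*} [Field K]

variable (K) in
/-- The derivation `∂/∂x` on `K[y][x]`, over the base field. -/
noncomputable abbrev xDeriv : Derivation K K[X][X] K[X][X] := derivative'.restrictScalars K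

lemma xDeriv_apply (p : K[X][X]) : xDeriv K p = derivative p := rfl

variable [CharZero K]

lemma eq_C_C_of_derivatives_eq_zero (p : K[X][X]) (hx : derivative p = 0) (hy : yDeriv K p = 0) :
    ∃ k : K, p = C (C k) := by
  have h1 := eq_C_of_derivative_eq_zero hx
  have h2 : derivative (p.coeff 0) = 0 := by rw [← coeff_yDeriv, hy, coeff_zero]
  exact ⟨(p.coeff 0).coeff 0, by rw [← eq_C_of_derivative_eq_zero h2, ← h1]⟩

lemma eq_zero_of_derivatives_eq_zero (p : K[X][X]) (hx : derivative p = 0)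
    (hy : yDeriv K p = 0) (h0 : (p.eval 0).eval 0 = 0) : p = 0 := by
  obtain ⟨k, rfl⟩ := eq_C_C_of_derivatives_eq_zero p hx hy
  simpa using h0

/-- Differentiate twice in `x`, cancelling `V_x` each time. -/
lemma coeffs_eq_zero_of_quadratic_eq_zero (V : K[X][X]) (hV : derivative V ≠ 0) (κ d w : K)
    (h : C (C κ) * V ^ 2 - C (C d) * V + C (C w) = 0) : κ = 0 ∧ d = 0 := by
  have h1 := congrArg derivative h
  simp only [sq, derivative_add, derivative_sub, derivative_mul, derivative_C, derivative_zero]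
    at h1
  have h2 : 2 * C (C κ) * V - C (C d) = 0 := by
    have : derivative V * (2 * C (C κ) * V - C (C d)) = 0 := by linear_combination h1
    exact (mul_eq_zero.1 this).resolve_left hV
  have h3 := congrArg derivative h2
  simp only [derivative_sub, derivative_mul, derivative_C, derivative_zero,
    derivative_ofNat] at h3
  have h4 : (2 * C (C κ) : K[X][X]) = 0 := by
    have : derivative V * (2 * C (C κ)) = 0 := by linear_combination h3
    exact (mul_eq_zero.1 this).resolve_left hV
  have hκ : κ = 0 := by simpa using h4
  refine ⟨hκ, ?_⟩
  simpa [hκ] using h2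

/-- If `∂H/∂x` is a multiple of `∂V/∂x` by a polynomial in `y`, and the Jacobian determinant of
`V, H` vanishes, then `H` is a constant multiple of `V`. -/
lemma eq_mul_of_derivative_eq_mul (V H : K[X][X]) (s : K[X]) (hV : derivative V ≠ 0)
    (hJ : derivative V * yDeriv K H = yDeriv K V * derivative H)
    (hs : derivative H = C s * derivative V)
    (hV0 : (V.eval 0).eval 0 = 0) (hH0 : (H.eval 0).eval 0 = 0) :
    ∃ σ : K, H = C (C σ) * V := by
  have hy : yDeriv K H = C s * yDeriv K V := by
    apply mul_left_cancel₀ hV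
    rw [hJ, hs]; ring
  have h1 := congrArg (yDeriv K) hs
  rw [← derivative_coeffDeriv, hy, derivative_C_mul, Derivation.leibniz, coeffDeriv_C,
    derivative_coeffDeriv, smul_eq_mul, smul_eq_mul] at h1
  have h2 : derivative V * C (derivative s) = 0 := by
    have : derivative V * C (derivative' s) = 0 := by linear_combination -h1
    exact this
  have h3 : derivative s = 0 := C_eq_zero.1 ((mul_eq_zero.1 h2).resolve_left hV)
  obtain ⟨σ, rfl⟩ : ∃ σ, s = C σ := ⟨_, eq_C_of_derivative_eq_zero h3⟩
  refine ⟨σ, sub_eq_zero.1 (eq_zero_of_derivatives_eq_zero _ ?_ ?_ ?_)⟩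
  · rw [derivative_sub, derivative_C_mul, hs, sub_self]
  · rw [map_sub, Derivation.leibniz, coeffDeriv_C, hy, smul_eq_mul, smul_eq_mul]
    simp
  · simp [hV0, hH0]

/-- The classification in `K[y][x][z]`. -/
theorem trivariate_normal_form (U : K[X][X][X]) (V H : K[X][X])
    (e1 : coeffDeriv (xDeriv K) U + C (yDeriv K V) = 0)
    (e2 : coeffDeriv (xDeriv K) U * C (yDeriv K V) =
      coeffDeriv (yDeriv K) U * C (derivative V) + derivative U * C (derivative H))
    (e3 : derivative U * C (derivative V * yDeriv K H - yDeriv K V * derivative H) = 0)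
    (hU0 : ((U.eval 0).eval 0).eval 0 = 0) (hV0 : (V.eval 0).eval 0 = 0)
    (hH0 : (H.eval 0).eval 0 = 0)
    (hind : ∀ α β γ : K, C (C (C α)) * U + C (C (C β) * V + C (C γ) * H) = 0 →
      α = 0 ∧ β = 0 ∧ γ = 0) :
    ∃ (A : K[X]) (u₁ κ l d : K), A.natDegree ≠ 0 ∧ A.eval 0 = 0 ∧ u₁ ≠ 0 ∧ κ ≠ 0 ∧
      V = taylor (C κ * X ^ 2 + C l * X) (A.map C) ∧
      U = C (C (C u₁)) * X + C (C (C d * X)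
        - C (derivative (C κ * X ^ 2 + C l * X)) * V) ∧
      C (C u₁) * H = C (C κ) * V ^ 2 - C (C d) * V := by
  have f0 : derivative (U.coeff 0) = - yDeriv K V := by
    have := congrArg (fun p => p.coeff 0) e1
    simp only [coeff_add, coeff_coeffDeriv, coeff_C_zero, coeff_zero, xDeriv_apply] at this
    linear_combination this
  have fs : ∀ i, derivative (U.coeff (i + 1)) = 0 := by
    intro i
    have := congrArg (fun p => p.coeff (i + 1)) e1
    simpa only [coeff_add, coeff_coeffDeriv, coeff_C_succ, coeff_zero, add_zero,
      xDeriv_apply] using this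
  have g : ∀ i, derivative (U.coeff i) * yDeriv K V =
      yDeriv K (U.coeff i) * derivative V + U.coeff (i + 1) * (i + 1) * derivative H := by
    intro i
    have := congrArg (fun p => p.coeff i) e2
    simpa only [coeff_add, coeff_coeffDeriv, coeff_mul_C, coeff_derivative, xDeriv_apply]
      using this
  have hc0 : ((U.coeff 0).eval 0).eval 0 = 0 := by rwa [coeff_zero_eq_eval_zero]
  have hJ : derivative U ≠ 0 → derivative V * yDeriv K H = yDeriv K V * derivative H := by
    intro h
    exact sub_eq_zero.1 (C_eq_zero.1 ((mul_eq_zero.1 e3).resolve_left h))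
  -- If `V_x = 0`, the minor relation reads `-V_y² = U₁ H_x`, with `U₁` the coefficient of `z`.
  -- Either `U₁ = 0` or the determinant gives `V_y H_x = 0`; in both cases `V_y = 0`, so `V = 0`,
  -- against independence.
  have hVx : derivative V ≠ 0 := by
    intro hx
    have hg := g 0
    rw [hx, f0, mul_zero, zero_add] at hg
    have hy : yDeriv K V = 0 := by
      by_cases hU : derivative U = 0
      · have h1 : U.coeff 1 = 0 :=
          coeff_eq_zero_of_natDegree_lt (by rw [derivative_eq_zero.1 hU]; exact one_pos)
        rw [h1] at hg
        exact mul_self_eq_zero.1 (by linear_combination -hg)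
      · have := hJ hU
        rw [hx, zero_mul] at this
        rcases mul_eq_zero.1 this.symm with h | h
        · exact h
        · rw [h] at hg
          exact mul_self_eq_zero.1 (by linear_combination -hg)
    have hV : V = 0 := eq_zero_of_derivatives_eq_zero V hx hy hV0
    have := hind 0 1 0 (by simp [hV])
    exact one_ne_zero this.2.1
  have hconst : ∀ i, U.coeff (i + 2) = 0 → ∃ k, U.coeff (i + 1) = C (C k) := by
    intro i hi
    refine eq_C_C_of_derivatives_eq_zero _ (fs i) ?_
    have := g (i + 1)
    rw [fs i, hi, zero_mul, zero_mul, zero_mul, add_zero] at this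
    exact (mul_eq_zero.1 this.symm).resolve_right hVx
  have hdep : ∀ β γ : K, γ ≠ 0 → C (C β) * V + C (C γ) * H ≠ 0 := by
    intro β γ hγ h
    exact hγ (hind 0 β γ (by rw [h]; simp)).2.2
  obtain ⟨u₁, hu₁⟩ : ∃ k, U.coeff 1 = C (C k) ∧ U.natDegree ≤ 1 := by
    -- If the `z`-degree is `n + 2`, the top coefficient is a constant and the one below it depends
    -- only on `y`. The relation `g (n + 1)` then makes `H_x` a `K[y]`-multiple of `V_x`, so `H` is
    -- a constant multiple of `V`, against independence.
    have hle : U.natDegree ≤ 1 := by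
      by_contra! hlt
      obtain ⟨n, hn⟩ : ∃ n, U.natDegree = n + 2 := ⟨U.natDegree - 2, by omega⟩
      obtain ⟨c, hc⟩ := hconst (n + 1) (coeff_eq_zero_of_natDegree_lt (by omega))
      have hU0 : U ≠ 0 := by rintro rfl; simp at hn
      have hc0 : c ≠ 0 := by
        rintro rfl
        have : U.leadingCoeff = 0 := by rw [leadingCoeff, hn]; simpa using hc
        exact hU0 (leadingCoeff_eq_zero.1 this)
      have hdU : derivative U ≠ 0 := by
        rw [derivative_ne_zero]; omega
      have hg := g (n + 1)
      rw [fs n, hc, zero_mul] at hg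
      set m : K := c * ((n + 1 : ℕ) + 1) with hm
      have hm0 : m ≠ 0 := mul_ne_zero hc0 (by exact_mod_cast Nat.succ_ne_zero (n + 1))
      have hcm : C (C c) * (((n + 1 : ℕ) : K[X][X]) + 1) = C (C m) := by
        simp [hm]
      rw [hcm] at hg
      have hUn : yDeriv K (U.coeff (n + 1)) = C (derivative ((U.coeff (n + 1)).coeff 0)) := by
        conv_lhs => rw [eq_C_of_derivative_eq_zero (fs n)]
        rw [coeffDeriv_C]; rfl
      rw [hUn] at hg
      have hinv : (C (C m⁻¹) * C (C m) : K[X][X]) = 1 := by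
        rw [← C_mul, ← C_mul, inv_mul_cancel₀ hm0, C_1, C_1]
      obtain ⟨σ, hσ⟩ := eq_mul_of_derivative_eq_mul V H
        (- (C m⁻¹ * derivative ((U.coeff (n + 1)).coeff 0))) hVx (hJ hdU)
        (by
          rw [C_neg, C_mul]
          linear_combination (-(C (C m⁻¹))) * hg - derivative H * hinv) hV0 hH0
      refine hdep (-σ) 1 one_ne_zero ?_
      rw [hσ, C_neg, C_neg, C_1, C_1]; ring
    obtain ⟨k, hk⟩ := hconst 0 (coeff_eq_zero_of_natDegree_lt (by omega))
    exact ⟨k, hk, hle⟩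
  obtain ⟨hu₁, hle⟩ := hu₁
  have hUeq : U = C (C (C u₁)) * X + C (U.coeff 0) := by
    rw [← hu₁]; exact eq_X_add_C_of_natDegree_le_one hle
  have hdU : derivative U = C (C (C u₁)) := by
    rw [hUeq]; simp
  have hg := g 0
  rw [f0, zero_add, hu₁] at hg
  simp only [Nat.cast_zero, zero_add, mul_one] at hg
  -- Working with `u₁H` keeps the case `u₁ = 0`, not yet excluded, inside the same system.
  have hJ' : derivative V * yDeriv K (C (C u₁) * H) = yDeriv K V * derivative (C (C u₁) * H) := by
    by_cases h : u₁ = 0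
    · simp [h]
    · have := hJ (by rw [hdU]; simpa using h)
      rw [Derivation.leibniz, coeffDeriv_C, derivative_C_mul, smul_eq_mul, smul_eq_mul]
      have h0 : derivative' (C u₁ : K[X]) = 0 := derivative_C
      rw [h0, C_0]
      linear_combination C (C u₁) * this
  obtain ⟨A, κ, l, d, e, w, hA, hVA, hUA, hHA⟩ := exists_sheared_form V (U.coeff 0)
    (C (C u₁) * H) hVx f0 (by rw [derivative_C_mul]; linear_combination -hg) hJ'
  have hw : w = 0 := by
    have := congrArg (fun p => (p.eval 0).eval 0) hHA
    simpa [hV0, hH0] using this.symm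
  have he : e = 0 := by
    have := congrArg (fun p => (p.eval 0).eval 0) hUA
    simpa [hV0, hc0] using this.symm
  subst hw he
  rw [C_0, C_0, add_zero] at hHA
  rw [C_0, add_zero] at hUA
  -- If `u₁ = 0`, the quadratic relation for `V` forces `κ = d = 0`; then `b' = l` and `U = -lV`, a
  -- linear dependence.
  have hu : u₁ ≠ 0 := by
    rintro rfl
    obtain ⟨rfl, rfl⟩ := coeffs_eq_zero_of_quadratic_eq_zero V hVx κ d 0
      (by rw [← hHA]; simp)
    have h1 : U = C (U.coeff 0) := by simpa using hUeq
    have := hind 1 l 0 (by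
      rw [h1, hUA]
      simp)
    exact one_ne_zero this.1
  refine ⟨A, u₁, κ, l, d, hA, ?_, hu, ?_, hVA, ?_, hHA⟩
  · have h := hV0
    rw [hVA, taylor_eval, zero_add, ← coe_evalRingHom, eval_map, hom_eval₂] at h
    have hcomp : (evalRingHom (0 : K)).comp (C : K →+* K[X]) = RingHom.id K := by ext; simp
    rw [hcomp] at h
    simpa [coeff_zero_eq_eval_zero] using h
  · rintro rfl
    refine hdep d u₁ hu ?_
    rw [hHA]; simp
  · rw [← hUA]; exact hUeq

end Trivariate

/-! ### Passage between `K[x,y,z]` and `K[y][x][z]` -/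

section Tower

open Polynomial

variable {K : Type*} [Field K]

/-- The map `K[x,y,z] → K[y][x][z]`. -/
noncomputable def toTower : MvPolynomial (Fin 3) K →ₐ[K] K[X][X][X] :=
  MvPolynomial.aeval (![C X, C (C X), X] : Fin 3 → K[X][X][X])

/-- The map `K[y][x][z] → K[x,y,z]`. -/
noncomputable def ofTower : K[X][X][X] →+* MvPolynomial (Fin 3) K :=
  eval₂RingHom (eval₂RingHom (eval₂RingHom MvPolynomial.C (MvPolynomial.X 1))
    (MvPolynomial.X 0)) (MvPolynomial.X 2)

@[simp] lemma toTower_C (c : K) : toTower (MvPolynomial.C c) = C (C (C c)) := by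
  simp only [toTower, MvPolynomial.aeval_C]; rfl

@[simp] lemma toTower_X_zero : toTower (MvPolynomial.X 0 : MvPolynomial (Fin 3) K) = C X := by
  simp [toTower]

@[simp] lemma toTower_X_one :
    toTower (MvPolynomial.X 1 : MvPolynomial (Fin 3) K) = C (C X) := by
  simp [toTower]

@[simp] lemma toTower_X_two : toTower (MvPolynomial.X 2 : MvPolynomial (Fin 3) K) = X := by
  simp [toTower]

lemma ofTower_toTower (p : MvPolynomial (Fin 3) K) : ofTower (toTower p) = p := by
  induction p using MvPolynomial.induction_on with
  | C a => simp [ofTower]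
  | add p q hp hq => rw [map_add, map_add, hp, hq]
  | mul_X p i hp =>
    have hX : ∀ i : Fin 3, ofTower (toTower (MvPolynomial.X i)) =
        (MvPolynomial.X i : MvPolynomial (Fin 3) K) := by
      intro i
      match i with
      | 0 => rw [toTower_X_zero]; simp [ofTower]
      | 1 => rw [toTower_X_one]; simp [ofTower]
      | 2 => rw [toTower_X_two]; simp [ofTower]
    rw [map_mul, map_mul, hp, hX]

lemma toTower_injective : Function.Injective (toTower (K := K)) :=
  Function.LeftInverse.injective ofTower_toTower

/-- A derivation is determined by its values on the variables. -/
lemma toTower_pderiv_of_derivation (i : Fin 3) (D : Derivation K K[X][X][X] K[X][X][X])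
    (hD : ∀ j, D (toTower (MvPolynomial.X j)) = toTower ((Pi.single i 1 : Fin 3 → MvPolynomial (Fin 3) K) j))
    (p : MvPolynomial (Fin 3) K) :
    toTower (MvPolynomial.pderiv i p) = D (toTower p) := by
  induction p using MvPolynomial.induction_on with
  | C a =>
    have : toTower (MvPolynomial.C a) = algebraMap K K[X][X][X] a := by
      rw [toTower_C]; rfl
    rw [MvPolynomial.pderiv_C, map_zero, this, D.map_algebraMap]
  | add p q hp hq => simp only [map_add, hp, hq]
  | mul_X p j hp =>
    rw [Derivation.leibniz, map_mul, Derivation.leibniz, hD, MvPolynomial.pderiv_X, map_add,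
      smul_eq_mul, smul_eq_mul, smul_eq_mul, smul_eq_mul, map_mul, map_mul, hp]

lemma toTower_pderiv_zero (p : MvPolynomial (Fin 3) K) :
    toTower (MvPolynomial.pderiv 0 p) = coeffDeriv (xDeriv K) (toTower p) := by
  apply toTower_pderiv_of_derivation
  intro j
  fin_cases j <;> simp

lemma toTower_pderiv_one (p : MvPolynomial (Fin 3) K) :
    toTower (MvPolynomial.pderiv 1 p) = coeffDeriv (yDeriv K) (toTower p) := by
  apply toTower_pderiv_of_derivation
  intro j
  fin_cases j <;> simp [derivative'_apply]

lemma toTower_pderiv_two (p : MvPolynomial (Fin 3) K) :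
    toTower (MvPolynomial.pderiv 2 p) = derivative (toTower p) := by
  apply toTower_pderiv_of_derivation (D := derivative'.restrictScalars K)
  intro j
  change derivative _ = _
  fin_cases j <;> simp

lemma eval_toTower (p : MvPolynomial (Fin 3) K) :
    (((toTower p).eval 0).eval 0).eval 0 = MvPolynomial.eval 0 p := by
  induction p using MvPolynomial.induction_on with
  | C a => simp
  | add p q hp hq => simp [hp, hq]
  | mul_X p i hp => fin_cases i <;> simp

lemma exists_toTower_eq_C (p : MvPolynomial (Fin 3) K)
    (hp : p ∈ MvPolynomial.supported K ({0, 1} : Set (Fin 3))) : ∃ q, toTower p = C q := by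
  have : MvPolynomial.supported K ({0, 1} : Set (Fin 3)) ≤
      (CAlgHom (R := K) (A := K[X][X])).range.comap toTower := by
    rw [MvPolynomial.supported_eq_adjoin_X, Algebra.adjoin_le_iff]
    rintro _ ⟨i, hi, rfl⟩
    rcases hi with rfl | rfl
    · exact ⟨X, by simp⟩
    · exact ⟨C X, by simp⟩
  obtain ⟨q, hq⟩ := this hp
  exact ⟨q, hq.symm⟩

lemma toTower_aeval_X_one (b : K[X]) :
    toTower (aeval (MvPolynomial.X 1 : MvPolynomial (Fin 3) K) b) = C (C b) := by
  induction b using Polynomial.induction_on' with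
  | add p q hp hq => simp only [map_add, hp, hq]
  | monomial n a =>
    rw [aeval_monomial, MvPolynomial.algebraMap_eq, map_mul, toTower_C, map_pow, toTower_X_one,
      ← C_mul_X_pow_eq_monomial]
    simp only [C_mul, C_pow]

/-- Identifies the Taylor shift of the tower with the substitution `A(x + b(y))` used in the final
formulas. -/
lemma toTower_aeval_shear (A b : K[X]) :
    toTower (aeval (MvPolynomial.X 0 + aeval (MvPolynomial.X 1 : MvPolynomial (Fin 3) K) b) A) =
      C (taylor b (A.map C)) := by
  induction A using Polynomial.induction_on' with
  | add p q hp hq => simp only [map_add, Polynomial.map_add, hp, hq]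
  | monomial n a =>
    rw [aeval_monomial, MvPolynomial.algebraMap_eq, map_mul, toTower_C, map_pow, map_add,
      toTower_X_zero, toTower_aeval_X_one, map_monomial, taylor_monomial]
    simp only [C_mul, C_pow, C_add]

end Tower

/-! ### Nilpotency relations and the conclusion -/

/-- The trace relations of a nilpotent `3 × 3` matrix with two zeros in its last column. -/
lemma relations_of_isNilpotent {R : Type*} [CommRing R] [IsDomain R] [CharZero R]
    (M : Matrix (Fin 3) (Fin 3) R) (h12 : M 1 2 = 0) (h22 : M 2 2 = 0) (hM : IsNilpotent M) :
    M 0 0 + M 1 1 = 0 ∧ M 0 0 * M 1 1 = M 0 1 * M 1 0 + M 0 2 * M 2 0 ∧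
      M 0 2 * (M 1 0 * M 2 1 - M 1 1 * M 2 0) = 0 := by
  have h1 : M.trace = 0 := (Matrix.isNilpotent_trace_of_isNilpotent hM).eq_zero
  have h2 : (M * M).trace = 0 := by
    rw [← sq]
    exact (Matrix.isNilpotent_trace_of_isNilpotent (hM.pow_of_pos two_ne_zero)).eq_zero
  have h3 : M.det = 0 := by
    obtain ⟨n, hn⟩ := hM
    have : M.det ^ n = 0 := by
      rw [← Matrix.det_pow, hn]
      by_cases h0 : n = 0
      · subst h0
        exact absurd hn one_ne_zero
      · exact Matrix.det_zero
    exact eq_zero_of_pow_eq_zero this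
  rw [Matrix.trace_fin_three, h22] at h1
  rw [Matrix.trace_fin_three] at h2
  simp only [Matrix.mul_apply, Fin.sum_univ_three, h12, h22] at h2
  rw [Matrix.det_fin_three, h12, h22] at h3
  refine ⟨by linear_combination h1, ?_, by linear_combination h3⟩
  -- Twice the sum of the principal 2×2 minors is `(tr M)² - tr (M²)`.
  apply mul_left_cancel₀ (two_ne_zero (α := R))
  linear_combination (M 0 0 + M 1 1) * h1 - h2

/-- The variables are `x = X 0`, `y = X 1`, `z = X 2`. -/
theorem proposition3p1 {K : Type*} [Field K] [IsAlgClosed K] [CharZero K]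
    (u v h : MvPolynomial (Fin 3) K)
    -- `v` and `h` are polynomials in `x` and `y` only
    (hv : v ∈ MvPolynomial.supported K ({0, 1} : Set (Fin 3)))
    (hh : h ∈ MvPolynomial.supported K ({0, 1} : Set (Fin 3)))
    (h0 : ∀ i, MvPolynomial.eval (0 : Fin 3 → K) (![u, v, h] i) = 0)
    (hind : LinearIndependent K ![u, v, h])
    (hnil : IsNilpotent (polyJacobian ![u, v, h]))
    (hdeg : Nat.gcd (v.degreeOf 0) (h.degreeOf 0) ≤ 3 ∨
      (v.degreeOf 0).Prime ∨ (h.degreeOf 0).Prime) :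
    ∃ (u₁ c₀ a l₁ l₂ l₂' : K) (g b : Polynomial K),
      u₁ ≠ 0 ∧ c₀ ≠ 0 ∧ a ≠ 0 ∧
      g.eval 0 = 0 ∧ 1 ≤ g.natDegree ∧
      b = Polynomial.C (u₁ * c₀ * a) * Polynomial.X ^ 2 + Polynomial.C l₁ * Polynomial.X
        + Polynomial.C l₂' ∧
      u = MvPolynomial.C u₁ * MvPolynomial.X 2
        - MvPolynomial.C a⁻¹
          * Polynomial.aeval (MvPolynomial.X 1 : MvPolynomial (Fin 3) K) (Polynomial.derivative b)
          * Polynomial.aeval (MvPolynomial.C a * MvPolynomial.X 0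
              + Polynomial.aeval (MvPolynomial.X 1 : MvPolynomial (Fin 3) K) b) g
        - MvPolynomial.C (u₁ * l₂) * MvPolynomial.X 1 ∧
      v = Polynomial.aeval (MvPolynomial.C a * MvPolynomial.X 0
            + Polynomial.aeval (MvPolynomial.X 1 : MvPolynomial (Fin 3) K) b) g ∧
      h = MvPolynomial.C c₀ * v ^ 2 + MvPolynomial.C l₂ * v := by
  have htop : ∀ w, w ∈ ({v, h} : Set (MvPolynomial (Fin 3) K)) →
      MvPolynomial.pderiv 2 w = 0 := by
    intro w hw
    obtain ⟨q, hq⟩ : ∃ q, toTower w = Polynomial.C q := by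
      rcases hw with rfl | rfl
      exacts [exists_toTower_eq_C _ hv, exists_toTower_eq_C _ hh]
    apply toTower_injective
    rw [toTower_pderiv_two, hq, Polynomial.derivative_C, map_zero]
  obtain ⟨r1, r2, r3⟩ := relations_of_isNilpotent _ (htop v (by simp)) (htop h (by simp)) hnil
  obtain ⟨V, hV⟩ := exists_toTower_eq_C v hv
  obtain ⟨H, hH⟩ := exists_toTower_eq_C h hh
  have e1 := congrArg toTower r1
  have e2 := congrArg toTower r2
  have e3 := congrArg toTower r3
  simp only [polyJacobian, Matrix.of_apply, Matrix.cons_val_zero, Matrix.cons_val_one,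
    Matrix.cons_val, map_add, map_mul, map_sub, map_zero, toTower_pderiv_zero,
    toTower_pderiv_one, toTower_pderiv_two, hV, hH, coeffDeriv_C, xDeriv_apply] at e1 e2 e3
  have hu0 := h0 0
  have hv0 := h0 1
  have hh0 := h0 2
  simp only [Matrix.cons_val_zero, Matrix.cons_val_one, Matrix.cons_val] at hu0 hv0 hh0
  rw [← eval_toTower] at hu0 hv0 hh0
  rw [hV, Polynomial.eval_C] at hv0
  rw [hH, Polynomial.eval_C] at hh0
  obtain ⟨A, u₁, κ, l, d, hA, hA0, hu₁, hκ, hVA, hUA, hHA⟩ :=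
    trivariate_normal_form (toTower u) V H e1 e2
      (by simpa only [Polynomial.C_sub, Polynomial.C_mul] using e3) hu0 hv0 hh0 (by
        intro α β γ habc
        have h1 : α • u + β • v + γ • h = 0 := by
          apply toTower_injective
          simp only [MvPolynomial.smul_eq_C_mul, map_add, map_mul, toTower_C, hV, hH, map_zero]
          rw [Polynomial.C_add, Polynomial.C_mul, Polynomial.C_mul] at habc
          rw [← habc]; ring
        have h2 := Fintype.linearIndependent_iff.1 hind ![α, β, γ] (by
          simpa [Fin.sum_univ_three] using h1)
        exact ⟨h2 0, h2 1, h2 2⟩)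
  have hv' : v = Polynomial.aeval (MvPolynomial.C 1 * MvPolynomial.X 0
      + Polynomial.aeval (MvPolynomial.X 1 : MvPolynomial (Fin 3) K)
        (Polynomial.C κ * Polynomial.X ^ 2 + Polynomial.C l * Polynomial.X)) A := by
    apply toTower_injective
    rw [map_one, one_mul, toTower_aeval_shear, hV, hVA]
  have hh' : MvPolynomial.C u₁ * h = MvPolynomial.C κ * v ^ 2 - MvPolynomial.C d * v := by
    apply toTower_injective
    simpa only [map_mul, map_sub, map_pow, toTower_C, hV, hH] using congrArg Polynomial.C hHA
  have hu' : u = MvPolynomial.C u₁ * MvPolynomial.X 2 + (MvPolynomial.C d * MvPolynomial.X 1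
      - Polynomial.aeval (MvPolynomial.X 1 : MvPolynomial (Fin 3) K) (Polynomial.derivative
        (Polynomial.C κ * Polynomial.X ^ 2 + Polynomial.C l * Polynomial.X)) * v) := by
    apply toTower_injective
    rw [hUA]
    simp [hV]
  -- The shear is already normalised to `a = 1` and `b(0) = 0`. Dividing `u₁h = κv² - dv` by `u₁`
  -- gives `c₀` and `l₂`, and `u₁c₀a = κ` is the quadratic coefficient of `b`.
  refine ⟨u₁, κ / u₁, 1, l, -d / u₁, 0, A, _, hu₁, div_ne_zero hκ hu₁, one_ne_zero, hA0,
    Nat.one_le_iff_ne_zero.2 hA, rfl, ?_, ?_, ?_⟩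
  · rw [show u₁ * (κ / u₁) * 1 = κ by field_simp, Polynomial.C_0, add_zero, ← hv', show u₁ * (-d / u₁) = -d by field_simp, hu']
    simp only [inv_one, map_one, map_neg]
    ring
  · rwa [show u₁ * (κ / u₁) * 1 = κ by field_simp, Polynomial.C_0, add_zero]
  · have hinv : (MvPolynomial.C u₁⁻¹ * MvPolynomial.C u₁ : MvPolynomial (Fin 3) K) = 1 := by
      rw [← map_mul, inv_mul_cancel₀ hu₁, map_one]
    rw [div_eq_mul_inv, div_eq_mul_inv, map_mul, map_mul, map_neg]
    linear_combination (-h) * hinv + MvPolynomial.C u₁⁻¹ * hh'
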